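/- Let $n\ge 1$. For a word $w=w_1w_2\cdots w_m$ of integers, let $\mathrm{des}(w)$ be the number of $i\in\{1,\dots,m-1\}$ with $w_i>w_{i+1}$ (descents), and let $\mathrm{plat}(w)$ be the number of $i\in\{1,\dots,m-1\}$ with $w_i=w_{i+1}$ (plateaus). Let $\mathcal{C}_n$ be the set of nonnesting permutations of the multiset $\{1,1,2,2,\dots,n,n\}$, that is, the permutations $\pi=\pi_1\pi_2\cdots\pi_{2n}$ of this multiset for which there are no indices $i<j<\ell<m$ with $\pi_i=\pi_m$ and $\pi_j=\pi_\ell$ (equivalently, those that avoid the patterns $1221$ and $2112$). Let $\mathcal{S}_n$ be the set of permutations of $\{1,\dots,n\}$. Let $\mathcal{D}_n$ be the set of Dyck paths from $(0,0)$ to $(n,n)$, that is, lattice paths with steps $\mathsf{E}=(1,0)$ and $\mathsf{N}=(0,1)$ that do not go above the diagonal $y=x$. A peak of $D\in\mathcal{D}_n$ is an occurrence of two adjacent steps $\mathsf{E}\mathsf{N}$; it is a low peak if these steps touch the diagonal, and a high peak otherwise. Let $\mathrm{lpea}(D)$ and $\mathrm{hpea}(D)$ be the numbers of low and high peaks of $D$.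 Define $$C_n(t,u)=\sum_{\pi\in\mathcal{C}_n}t^{\mathrm{des}(\pi)}u^{\mathrm{plat}(\pi)},\qquad A_n(t)=\sum_{\sigma\in\mathcal{S}_n}t^{\mathrm{des}(\sigma)},\qquad N_n(t,u)=\sum_{D\in\mathcal{D}_n}t^{\mathrm{hpea}(D)}u^{\mathrm{lpea}(D)}.$$ Then, as polynomials in $t$ and $u$, $$C_n(t,u)=A_n(t)\,N_n(t,u).$$ -/

import Mathlib

/-- The number of descents of a word `w = w₁ w₂ … w_m`:
the number of positions `i` with `1 ≤ i ≤ m - 1` and `w_i > w_{i+1}`. -/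
def des {m n : ℕ} (w : Fin m → Fin n) : ℕ :=
  (Finset.univ.filter fun i : Fin m => ∃ h : i.val + 1 < m, w ⟨i.val + 1, h⟩ < w i).card

/-- The number of plateaus of a word `w = w₁ w₂ … w_m`:
the number of positions `i` with `1 ≤ i ≤ m - 1` and `w_i = w_{i+1}`. -/
def plat {m n : ℕ} (w : Fin m → Fin n) : ℕ :=
  (Finset.univ.filter fun i : Fin m => ∃ h : i.val + 1 < m, w i = w ⟨i.val + 1, h⟩).card

/-- The word `w` is a permutation of the multiset `{1, 1, 2, 2, …, n, n}`
(with `Fin n` as the `n`-element ordered alphabet): every letter occurs exactly twice. -/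
def IsDoubledPerm {n : ℕ} (w : Fin (2 * n) → Fin n) : Prop :=
  ∀ k : Fin n, (Finset.univ.filter fun i => w i = k).card = 2

/-- There are no positions `i < j < l < m` with `w_i = w_m` and `w_j = w_l`. For permutations of
`{1, 1, …, n, n}` this is the same as avoiding the patterns `1221` and `2112`. -/
def IsNonnesting {n : ℕ} (w : Fin (2 * n) → Fin n) : Prop :=
  ¬ ∃ i j l m : Fin (2 * n), i < j ∧ j < l ∧ l < m ∧ w i = w m ∧ w j = w l

instance {n : ℕ} (w : Fin (2 * n) → Fin n) : Decidable (IsDoubledPerm w) := by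
  unfold IsDoubledPerm; infer_instance

instance {n : ℕ} (w : Fin (2 * n) → Fin n) : Decidable (IsNonnesting w) := by
  unfold IsNonnesting; infer_instance

/-- The set `𝒞_n` of nonnesting permutations of the multiset `{1, 1, …, n, n}`. -/
def nonnestingPerms (n : ℕ) : Finset (Fin (2 * n) → Fin n) :=
  Finset.univ.filter fun w => IsDoubledPerm w ∧ IsNonnesting w

/-- `C_n(t, u)`, the sum of `t ^ des(π) u ^ plat(π)` over the nonnesting permutations `π`;
the variable `t` is `X 0` and the variable `u` is `X 1`. -/
noncomputable def nonnestingPoly (n : ℕ) : MvPolynomial (Fin 2) ℤ :=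
  ∑ w ∈ nonnestingPerms n, MvPolynomial.X 0 ^ des w * MvPolynomial.X 1 ^ plat w

/-- The Eulerian polynomial `A_n(t)`, the sum of `t ^ des(σ)` over the permutations `σ` of an
`n`-element ordered set. -/
noncomputable def eulerianPoly (n : ℕ) : Polynomial ℤ :=
  ∑ σ : Equiv.Perm (Fin n), Polynomial.X ^ des (fun i => σ i)

/-- A peak of the Dyck path `p` occurs at index `i`: an east step (`U`) at index `i` is followed
by a north step (`D`). -/
def IsPeakAt (p : DyckWord) (i : ℕ) : Prop :=
  p.toList[i]? = some DyckStep.U ∧ p.toList[i + 1]? = some DyckStep.D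

/-- After its first `i` steps the Dyck path `p` is on the diagonal. -/
def OnDiagonal (p : DyckWord) (i : ℕ) : Prop :=
  (p.toList.take i).count DyckStep.U = (p.toList.take i).count DyckStep.D

instance (p : DyckWord) (i : ℕ) : Decidable (IsPeakAt p i) := by
  unfold IsPeakAt; infer_instance

instance (p : DyckWord) (i : ℕ) : Decidable (OnDiagonal p i) := by
  unfold OnDiagonal; infer_instance

/-- The number of low peaks (hills): peaks whose two steps touch the diagonal. The two steps
of a peak touch the diagonal if and only if the first one starts on it (and then the second one
ends on it). -/
def lowPeaks (p : DyckWord) : ℕ :=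
  ((Finset.range p.toList.length).filter fun i => IsPeakAt p i ∧ OnDiagonal p i).card

/-- The number of high peaks: peaks that are not low. -/
def highPeaks (p : DyckWord) : ℕ :=
  ((Finset.range p.toList.length).filter fun i => IsPeakAt p i ∧ ¬ OnDiagonal p i).card

/-- The Narayana polynomial `N_n(t, u)`, the sum of `t ^ hpea(D) u ^ lpea(D)` over the Dyck paths
`D` of semilength `n`; the variable `t` is `X 0` and the variable `u` is `X 1`. -/
noncomputable def narayanaPoly (n : ℕ) : MvPolynomial (Fin 2) ℤ :=
  ∑ p : {p : DyckWord // p.semilength = n},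
    MvPolynomial.X 0 ^ highPeaks p.1 * MvPolynomial.X 1 ^ lowPeaks p.1

/-! Every nonnesting permutation is uniquely `σ ∘ c`, where `σ` is the order in which its letters
first occur and `c` is canonical, that is, has first and second occurrences both in increasing
order. Canonical words correspond to Dyck paths, with east steps at first occurrences; descents
become high peaks and plateaus low peaks, so `fiberPoly 1` is the Narayana polynomial
(`fiberPoly_one`). It remains to see that `fiberPoly σ` is `t ^ des σ` times `fiberPoly 1`
(`fiberPoly_eq`).

This is proved by moving `σ` to the identity with two kinds of moves that preserve the relation
`FiberEquiv`. Adding 1 cyclically to all values changes the descents of a word by an amount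
depending only on its end letters, and `σ ∘ c` has the same end letters as `σ`
(`fiberEquiv_rotate`). Exchanging two cyclically consecutive values at nonadjacent positions of `σ`
is matched by an involution on canonical words that preserves both statistics (`fiberEquiv_swap`).
These moves connect all permutations (`IsRotationSwapInvariant.rel_one`). -/

/-! ### Connectedness of the permutations under rotations and swaps. -/

/-- An equivalence relation on permutations of `Fin (m + 1)` invariant under cyclic rotation of the
values and under exchanging two cyclically consecutive values in nonadjacent positions. -/
structure IsRotationSwapInvariant {m : ℕ}
    (r : Equiv.Perm (Fin (m + 1)) → Equiv.Perm (Fin (m + 1)) → Prop) : Prop where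
  equiv : Equivalence r
  rotate : ∀ σ, r σ (Equiv.addRight 1 * σ)
  swap : ∀ (σ : Equiv.Perm (Fin (m + 1))) (a b : Fin (m + 1)), a.val + 1 < b.val →
    σ b = σ a + 1 → r σ (σ * Equiv.swap a b)

namespace IsRotationSwapInvariant

variable {m : ℕ} {r : Equiv.Perm (Fin (m + 1)) → Equiv.Perm (Fin (m + 1)) → Prop}

/-- The value at `x` is swapped with those at `k`, `k - 1`, … in turn; `j` counts the swaps done.
Each swap raises one block entry by 1 and leaves at `x` the value just above the next entry to
treat. The swaps are allowed because `x` lies beyond `k + 1`. -/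
theorem exists_shift_block_partial (hr : IsRotationSwapInvariant r)
    (σ : Equiv.Perm (Fin (m + 1))) (k x : Fin (m + 1)) (hkx : k.val + 1 < x.val)
    (hx : σ x = σ k + 1) (hblock : ∀ i ≤ k, σ i = σ 0 + i) (j : ℕ) (hj : j ≤ k.val + 1) :
    ∃ τ, r σ τ ∧ (∀ i : Fin (m + 1), i.val + j < k.val + 1 → τ i = σ i) ∧
      (∀ i ≤ k, k.val + 1 ≤ i.val + j → τ i = σ i + 1) ∧
      (∀ i : Fin (m + 1), i.val + j = k.val → τ x = σ i + 1) ∧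
      ∀ y, k < y → y ≠ x → τ y = σ y := by
  induction j with
  | zero =>
    refine ⟨σ, hr.equiv.refl σ, fun _ _ => rfl, fun i hi h => ?_, fun i hi => ?_,
      fun _ _ _ => rfl⟩
    · have := Fin.le_def.1 hi
      omega
    · obtain rfl : i = k := Fin.ext (by omega)
      exact hx
  | succ j ih =>
    obtain ⟨τ, h1, h2, h3, h4, h5⟩ := ih (by omega)
    obtain ⟨e, he⟩ : ∃ e : Fin (m + 1), e.val + j = k.val := ⟨⟨k.val - j, by omega⟩, by
      simp only; omega⟩
    have hex : e ≠ x := by rintro rfl; omega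
    have hτe : τ e = σ e := h2 e (by omega)
    have hτx : τ x = τ e + 1 := by rw [h4 e he, hτe]
    refine ⟨τ * Equiv.swap e x, hr.equiv.trans h1 (hr.swap τ e x (by omega) hτx), ?_, ?_, ?_, ?_⟩
    · intro i hi
      have hie : i ≠ e := by rintro rfl; omega
      have hix : i ≠ x := by rintro rfl; omega
      rw [Equiv.Perm.mul_apply, Equiv.swap_apply_of_ne_of_ne hie hix, h2 i (by omega)]
    · intro i hi h
      have hi' := Fin.le_def.1 hi
      have hix : i ≠ x := by rintro rfl; omega
      by_cases hie : i = e
      · subst hie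
        rw [Equiv.Perm.mul_apply, Equiv.swap_apply_left, hτx, hτe]
      · have : i.val ≠ e.val := fun h => hie (Fin.ext h)
        rw [Equiv.Perm.mul_apply, Equiv.swap_apply_of_ne_of_ne hie hix, h3 i hi (by omega)]
    · intro i hi
      have hie : e = i + 1 := by
        apply Fin.ext
        rw [Fin.val_add_one_of_lt' (by omega)]
        omega
      rw [Equiv.Perm.mul_apply, Equiv.swap_apply_right, hτe,
        hblock e (Fin.le_def.2 (by omega)), hblock i (Fin.le_def.2 (by omega)), hie, add_assoc]
    · intro y hy hyx
      have hye : y ≠ e := by rintro rfl; have := Fin.lt_def.1 hy; omega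
      rw [Equiv.Perm.mul_apply, Equiv.swap_apply_of_ne_of_ne hye hyx, h5 y hy hyx]

/-- Shifting the whole block up by 1 fixes the value at `l`, so the cyclic distance `d` from the end
of the block to that value drops by 1. The block is extended once the distance is 1. -/
theorem exists_extend_block (hr : IsRotationSwapInvariant r) (k l : Fin (m + 1))
    (hkl : l.val = k.val + 1) (d : ℕ) (σ : Equiv.Perm (Fin (m + 1)))
    (hd : (σ l - σ k).val = d) (hblock : ∀ i ≤ k, σ i = σ 0 + i) :
    ∃ τ, r σ τ ∧ ∀ i ≤ l, τ i = τ 0 + i := by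
  have hlk : l = k + 1 := Fin.ext (by rw [Fin.val_add_one_of_lt' (by omega)]; omega)
  have hle : ∀ i ≤ l, i ≤ k ∨ i = l := by
    intro i hi
    rcases hi.eq_or_lt with h | h
    · exact Or.inr h
    · left
      rw [Fin.le_def]
      have := Fin.lt_def.1 h
      omega
  induction d generalizing σ with
  | zero =>
    have h : σ l - σ k = 0 := Fin.ext (by rw [hd]; rfl)
    have := σ.injective (sub_eq_zero.1 h)
    subst this
    omega
  | succ d ih =>
    obtain ⟨x, hx⟩ := σ.surjective (σ k + 1)
    have hkx : ¬ x ≤ k := by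
      intro h
      rw [hblock x h, hblock k le_rfl, add_assoc, ← hlk] at hx
      rw [add_left_cancel hx, Fin.le_def] at h
      omega
    by_cases hxl : x = l
    · subst hxl
      refine ⟨σ, hr.equiv.refl σ, fun i hi => ?_⟩
      rcases hle i hi with h | rfl
      · exact hblock i h
      · rw [hx, hblock k le_rfl, add_assoc, ← hlk]
    have hkx' : k.val + 1 < x.val := by
      have h1 : x.val ≠ l.val := fun h => hxl (Fin.ext h)
      rw [Fin.le_def] at hkx
      omega
    obtain ⟨τ, h1, -, h2, -, h3⟩ :=
      hr.exists_shift_block_partial σ k x hkx' hx hblock (k.val + 1) le_rfl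
    have h2' : ∀ i ≤ k, τ i = σ i + 1 := fun i hi => h2 i hi (by omega)
    have hl : τ l = σ l := h3 l (Fin.lt_def.2 (by omega)) (Ne.symm hxl)
    have hdist : (τ l - τ k).val = d := by
      have h4 : τ l - τ k + 1 = σ l - σ k := by rw [hl, h2' k le_rfl]; abel
      -- Otherwise adding 1 would wrap to 0, against the distance `d + 1`.
      have h5 : τ l - τ k ≠ Fin.last m := by
        intro h
        rw [h, Fin.last_add_one] at h4
        rw [← h4] at hd
        simp at hd
      have h6 := Fin.val_add_one_of_lt (Fin.lt_last_iff_ne_last.2 h5)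
      rw [h4, hd] at h6
      omega
    obtain ⟨ρ, h7, h8⟩ := ih τ hdist (fun i hi => by
      rw [h2' i hi, h2' 0 (Fin.zero_le _), hblock i hi]; abel)
    exact ⟨ρ, hr.equiv.trans h1 h7, h8⟩

theorem exists_block (hr : IsRotationSwapInvariant r) (σ : Equiv.Perm (Fin (m + 1))) (k : ℕ)
    (hk : k ≤ m) : ∃ τ, r σ τ ∧ ∀ i : Fin (m + 1), i.val ≤ k → τ i = τ 0 + i := by
  induction k with
  | zero =>
    refine ⟨σ, hr.equiv.refl σ, fun i hi => ?_⟩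
    obtain rfl : i = 0 := Fin.ext (by simpa using hi)
    rw [add_zero]
  | succ k ih =>
    obtain ⟨τ, h1, h2⟩ := ih (by omega)
    obtain ⟨ρ, h3, h4⟩ := hr.exists_extend_block ⟨k, by omega⟩ ⟨k + 1, by omega⟩ rfl _ τ rfl
      (fun i hi => h2 i hi)
    exact ⟨ρ, hr.equiv.trans h1 h3, fun i hi => h4 i hi⟩

/-- A block that fills all positions is a rotation of the identity. -/
theorem rel_one (hr : IsRotationSwapInvariant r) (σ : Equiv.Perm (Fin (m + 1))) : r σ 1 := by
  obtain ⟨τ, h1, h2⟩ := hr.exists_block σ m le_rfl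
  refine hr.equiv.trans h1 (hr.equiv.symm ?_)
  have key : ∀ j : ℕ, ∀ ρ : Equiv.Perm (Fin (m + 1)), (ρ 0).val = j →
      (∀ i, ρ i = ρ 0 + i) → r 1 ρ := by
    intro j
    induction j with
    | zero =>
      intro ρ h0 h
      obtain rfl : ρ = 1 := Equiv.ext fun i => by
        rw [h i, show ρ 0 = 0 from Fin.ext h0, zero_add]; rfl
      exact hr.equiv.refl _
    | succ j ih =>
      intro ρ h0 h
      have h3 := hr.rotate (Equiv.addRight (-1) * ρ)
      rw [← mul_assoc, show (Equiv.addRight 1 * Equiv.addRight (-1) :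
        Equiv.Perm (Fin (m + 1))) = 1 from Equiv.ext fun i => by simp, one_mul] at h3
      refine hr.equiv.trans (ih _ ?_ fun i => ?_) h3
      · have h4 : (ρ 0 + -1) + 1 = ρ 0 := by abel
        have h5 : ρ 0 + -1 ≠ Fin.last m := by
          intro h
          rw [h, Fin.last_add_one] at h4
          rw [← h4] at h0
          simp at h0
        have h6 := Fin.val_add_one_of_lt (Fin.lt_last_iff_ne_last.2 h5)
        rw [h4, h0] at h6
        exact (Nat.succ.inj h6).symm
      · simp only [Equiv.Perm.mul_apply, Equiv.coe_addRight]
        rw [h i]; abel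
  exact key _ τ rfl fun i => h2 i (by omega)

end IsRotationSwapInvariant

/-! ### Factoring a nonnesting permutation as an order and a canonical word. -/

/-- The letters of `c` occur for the first time in increasing order, at the positions `p`, and for
the second time in increasing order, at the positions `q`. -/
structure IsCanonicalWith {n : ℕ} (c : Fin (2 * n) → Fin n) (p q : Fin n → Fin (2 * n)) :
    Prop where
  strictMono_fst : StrictMono p
  strictMono_snd : StrictMono q
  lt : ∀ x, p x < q x
  apply_fst : ∀ x, c (p x) = x
  apply_snd : ∀ x, c (q x) = x

open Classical in
/-- The nonnesting permutations of `{1, 1, …, n, n}` whose letters first occur in increasing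
order. -/
noncomputable def canonicalWords (n : ℕ) : Finset (Fin (2 * n) → Fin n) :=
  Finset.univ.filter fun c => ∃ p q, IsCanonicalWith c p q

theorem mem_canonicalWords {n : ℕ} {c : Fin (2 * n) → Fin n} :
    c ∈ canonicalWords n ↔ ∃ p q, IsCanonicalWith c p q := by
  simp [canonicalWords]

namespace IsCanonicalWith

variable {n : ℕ} {c : Fin (2 * n) → Fin n} {p q : Fin n → Fin (2 * n)}

theorem fst_ne_snd (h : IsCanonicalWith c p q) (x y : Fin n) : p x ≠ q y := by
  intro e
  have h1 := h.apply_fst x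
  rw [e, h.apply_snd] at h1
  subst h1
  exact (h.lt y).ne e

theorem eq_fst_or_eq_snd (h : IsCanonicalWith c p q) (i : Fin (2 * n)) :
    i = p (c i) ∨ i = q (c i) := by
  have hinj : Function.Injective (Sum.elim p q) :=
    h.strictMono_fst.injective.sumElim h.strictMono_snd.injective h.fst_ne_snd
  -- The `n + n` positions given by `p` and `q` are distinct, so they exhaust all `2 * n`.
  have hsurj := ((Fintype.bijective_iff_injective_and_card _).2
    ⟨hinj, by simp [two_mul]⟩).surjective
  obtain ⟨x | x, hx⟩ := hsurj i
  · left; rw [← hx]; simp [h.apply_fst]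
  · right; rw [← hx]; simp [h.apply_snd]

theorem apply_eq_iff (h : IsCanonicalWith c p q) (i : Fin (2 * n)) (x : Fin n) :
    c i = x ↔ i = p x ∨ i = q x := by
  constructor
  · rintro rfl
    exact h.eq_fst_or_eq_snd i
  · rintro (rfl | rfl)
    · exact h.apply_fst x
    · exact h.apply_snd x

theorem eq_fst_snd_of_lt (h : IsCanonicalWith c p q) {i j : Fin (2 * n)} (hij : i < j)
    (hc : c i = c j) : i = p (c i) ∧ j = q (c i) := by
  have h0 := h.lt (c i)
  rcases h.eq_fst_or_eq_snd i with h1 | h1 <;> rcases h.eq_fst_or_eq_snd j with h2 | h2 <;>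
    rw [← hc] at h2
  · exact absurd (h1.trans h2.symm) hij.ne
  · exact ⟨h1, h2⟩
  · rw [← h1, ← h2] at h0
    exact absurd h0 hij.not_gt
  · exact absurd (h1.trans h2.symm) hij.ne

theorem comp_mem_nonnestingPerms (h : IsCanonicalWith c p q) (σ : Equiv.Perm (Fin n)) :
    ⇑σ ∘ c ∈ nonnestingPerms n := by
  rw [nonnestingPerms, Finset.mem_filter]
  refine ⟨Finset.mem_univ _, fun k => ?_, ?_⟩
  · rw [show (Finset.univ.filter fun i => (⇑σ ∘ c) i = k) = {p (σ.symm k), q (σ.symm k)} from ?_,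
      Finset.card_pair (h.fst_ne_snd _ _)]
    ext i
    simp only [Finset.mem_filter, Finset.mem_univ, true_and, Function.comp_apply,
      Finset.mem_insert, Finset.mem_singleton]
    rw [← h.apply_eq_iff, Equiv.eq_symm_apply]
  · rintro ⟨i, j, l, m, hij, hjl, hlm, him, hjl'⟩
    obtain ⟨h1, h2⟩ := h.eq_fst_snd_of_lt (hij.trans (hjl.trans hlm)) (σ.injective him)
    obtain ⟨h3, h4⟩ := h.eq_fst_snd_of_lt hjl (σ.injective hjl')
    rw [h1, h3, h.strictMono_fst.lt_iff_lt] at hij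
    rw [h2, h4, h.strictMono_snd.lt_iff_lt] at hlm
    exact hij.not_gt hlm

theorem fst_snd_unique (h : IsCanonicalWith c p q) {c' : Fin (2 * n) → Fin n}
    {p' q' : Fin n → Fin (2 * n)} (h' : IsCanonicalWith c' p' q') {τ : Equiv.Perm (Fin n)}
    (hτ : c' = ⇑τ ∘ c) (x : Fin n) : p x = p' (τ x) := by
  have h1 : c' (p x) = τ x := by rw [hτ, Function.comp_apply, h.apply_fst]
  have h2 : c' (q x) = τ x := by rw [hτ, Function.comp_apply, h.apply_snd]
  have h3 := (h'.eq_fst_snd_of_lt (h.lt x) (h1.trans h2.symm)).1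
  rwa [h1] at h3

end IsCanonicalWith

theorem comp_canonical_injective {n : ℕ} {c c' : Fin (2 * n) → Fin n} (hc : c ∈ canonicalWords n)
    (hc' : c' ∈ canonicalWords n) {σ σ' : Equiv.Perm (Fin n)} (h : ⇑σ ∘ c = ⇑σ' ∘ c') :
    σ = σ' ∧ c = c' := by
  obtain ⟨p, q, hp⟩ := mem_canonicalWords.1 hc
  obtain ⟨p', q', hp'⟩ := mem_canonicalWords.1 hc'
  have hτ : c' = ⇑(σ'⁻¹ * σ) ∘ c := by
    funext i
    have := congrFun h i
    simp only [Function.comp_apply] at this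
    simp [this]
  have hpp := hp.fst_snd_unique hp' hτ
  -- The relabelling between two canonical words respects the order of first occurrences, hence is
  -- monotone, hence trivial.
  have hmono : Monotone (σ'⁻¹ * σ : Equiv.Perm (Fin n)) := by
    intro x y hxy
    have := hp.strictMono_fst.monotone hxy
    rwa [hpp, hpp, hp'.strictMono_fst.le_iff_le] at this
  have h1 : σ'⁻¹ * σ = 1 := (Equiv.Perm.monotone_iff _).1 hmono
  rw [h1] at hτ
  exact ⟨(inv_mul_eq_one.1 h1).symm, hτ.symm⟩

/-- Nonnesting means that second occurrences come in the same order as first ones, so sorting the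
letters by first occurrence sorts both. -/
theorem exists_canonical_of_mem_nonnestingPerms {n : ℕ} {w : Fin (2 * n) → Fin n}
    (hw : w ∈ nonnestingPerms n) :
    ∃ σ : Equiv.Perm (Fin n), ∃ c ∈ canonicalWords n, ⇑σ ∘ c = w := by
  obtain ⟨-, h2, hnn⟩ := Finset.mem_filter.1 hw
  have hpq : ∀ x, ∃ p q : Fin (2 * n), p < q ∧ w p = x ∧ w q = x := by
    intro x
    obtain ⟨a, b, hab, he⟩ := Finset.card_eq_two.1 (h2 x)
    have ha : w a = x := by
      have : a ∈ Finset.univ.filter fun i => w i = x := by rw [he]; simp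
      simpa using this
    have hb : w b = x := by
      have : b ∈ Finset.univ.filter fun i => w i = x := by rw [he]; simp
      simpa using this
    rcases lt_or_gt_of_ne hab with h | h
    · exact ⟨a, b, h, ha, hb⟩
    · exact ⟨b, a, h, hb, ha⟩
  choose p q hlt hp hq using hpq
  have hpinj : Function.Injective p := fun x y h => by rw [← hp x, h, hp]
  have hqinj : Function.Injective q := fun x y h => by rw [← hq x, h, hq]
  have hmono : ∀ x y, p x < p y → q x < q y := by
    intro x y hxy
    by_contra hcon
    rcases (not_lt.1 hcon).eq_or_lt with h | h
    · rw [hqinj h] at hxy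
      exact lt_irrefl _ hxy
    · exact hnn ⟨p x, p y, q y, q x, hxy, hlt y, h, by rw [hp, hq], by rw [hp, hq]⟩
  have hs : StrictMono (p ∘ Tuple.sort p) :=
    (Tuple.monotone_sort p).strictMono_of_injective (hpinj.comp (Tuple.sort p).injective)
  refine ⟨Tuple.sort p, ⇑(Tuple.sort p)⁻¹ ∘ w, mem_canonicalWords.2
    ⟨p ∘ Tuple.sort p, q ∘ Tuple.sort p, hs, fun x y h => hmono _ _ (hs h), fun x => hlt _,
      fun x => ?_, fun x => ?_⟩, ?_⟩
  · simp [hp]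
  · simp [hq]
  · funext i; simp

/-- The contribution to `nonnestingPoly n` of the words whose letters first occur in the order
`σ`. -/
noncomputable def fiberPoly {n : ℕ} (σ : Equiv.Perm (Fin n)) : MvPolynomial (Fin 2) ℤ :=
  ∑ c ∈ canonicalWords n,
    MvPolynomial.X 0 ^ des (⇑σ ∘ c) * MvPolynomial.X 1 ^ plat (⇑σ ∘ c)

theorem nonnestingPoly_eq_sum_fiberPoly (n : ℕ) :
    nonnestingPoly n = ∑ σ : Equiv.Perm (Fin n), fiberPoly σ := by
  simp only [fiberPoly]
  rw [← Finset.sum_product', nonnestingPoly]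
  symm
  refine Finset.sum_nbij (fun x => ⇑x.1 ∘ x.2) ?_ ?_ ?_ fun _ _ => rfl
  · rintro ⟨σ, c⟩ h
    obtain ⟨p, q, hc⟩ := mem_canonicalWords.1 (Finset.mem_product.1 h).2
    exact hc.comp_mem_nonnestingPerms σ
  · rintro ⟨σ, c⟩ h ⟨σ', c'⟩ h' e
    obtain ⟨rfl, rfl⟩ := comp_canonical_injective (Finset.mem_product.1 h).2
      (Finset.mem_product.1 h').2 e
    rfl
  · intro w hw
    obtain ⟨σ, c, hc, e⟩ := exists_canonical_of_mem_nonnestingPerms hw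
    exact ⟨(σ, c), by simpa using hc, e⟩

/-! ### Descents under rotation of the values. -/

theorem des_eq_sum {l n : ℕ} (w : Fin (l + 1) → Fin n) :
    des w = ∑ i : Fin l, if w i.succ < w i.castSucc then 1 else 0 := by
  rw [des, Finset.card_filter, Fin.sum_univ_castSucc]
  simp [Fin.succ]

theorem sum_castSucc_sub_succ {l : ℕ} (g : Fin (l + 1) → ℤ) :
    ∑ i : Fin l, (g i.castSucc - g i.succ) = g 0 - g (Fin.last l) := by
  have h1 := Fin.sum_univ_succ g
  have h2 := Fin.sum_univ_castSucc g
  rw [Finset.sum_sub_distrib]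
  linarith

/-- Only the top value wraps around, so a comparison changes only if exactly one of the two letters
is the top one. The right side is a difference, so the sum over a word telescopes. -/
theorem lt_sub_rotate_lt {m : ℕ} (x y : Fin (m + 1)) :
    ((if y < x then 1 else 0 : ℤ) - if y + 1 < x + 1 then 1 else 0) =
      (if x = Fin.last m then 1 else 0) - if y = Fin.last m then 1 else 0 := by
  by_cases hx : x = Fin.last m <;> by_cases hy : y = Fin.last m
  · simp [hx, hy]
  · simp [hx, hy, Fin.lt_last_iff_ne_last]
  · have : (0 : Fin (m + 1)) < x + 1 := by
      rw [Fin.lt_def, Fin.val_add_one_of_lt (Fin.lt_last_iff_ne_last.2 hx)]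
      simp
    simp [hx, hy, this, (Fin.le_last x).not_gt]
  · have : y + 1 < x + 1 ↔ y < x := by
      rw [Fin.lt_def, Fin.val_add_one_of_lt (Fin.lt_last_iff_ne_last.2 hx),
        Fin.val_add_one_of_lt (Fin.lt_last_iff_ne_last.2 hy), Fin.lt_def]
      omega
    simp [hx, hy, this]

/-- Rotating the values of a word changes its number of descents by an amount that depends only on
the first and the last letter. -/
theorem des_sub_des_rotate {l m : ℕ} (w : Fin (l + 1) → Fin (m + 1)) :
    (des w : ℤ) - des (fun i => w i + 1) =
      (if w 0 = Fin.last m then 1 else 0) - if w (Fin.last l) = Fin.last m then 1 else 0 := by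
  rw [des_eq_sum, des_eq_sum, ← sum_castSucc_sub_succ fun i => if w i = Fin.last m then 1 else 0]
  push_cast
  rw [← Finset.sum_sub_distrib]
  exact Finset.sum_congr rfl fun i _ => lt_sub_rotate_lt _ _

theorem plat_comp_injective {l n k : ℕ} (w : Fin l → Fin n) {f : Fin n → Fin k}
    (hf : Function.Injective f) : plat (fun i => f (w i)) = plat w := by
  simp only [plat, hf.eq_iff]

namespace IsCanonicalWith

theorem apply_zero {m : ℕ} {c : Fin (2 * (m + 1)) → Fin (m + 1)} {p q}
    (h : IsCanonicalWith c p q) : c ⟨0, by omega⟩ = 0 := by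
  by_contra hne
  have h1 := h.strictMono_fst (Fin.pos_iff_ne_zero.2 hne)
  have h2 := h.lt (c ⟨0, by omega⟩)
  rw [Fin.lt_def] at h1 h2
  rcases h.eq_fst_or_eq_snd ⟨0, by omega⟩ with e | e
  · have := congrArg Fin.val e; simp only at this; omega
  · have := congrArg Fin.val e; simp only at this; omega

theorem apply_last {m : ℕ} {c : Fin (2 * (m + 1)) → Fin (m + 1)} {p q}
    (h : IsCanonicalWith c p q) : c ⟨2 * m + 1, by omega⟩ = Fin.last m := by
  by_contra hne
  have h1 := h.strictMono_snd (Fin.lt_last_iff_ne_last.2 hne)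
  have h2 := h.lt (c ⟨2 * m + 1, by omega⟩)
  have h3 := (q (Fin.last m)).isLt
  have h4 := (q (c ⟨2 * m + 1, by omega⟩)).isLt
  rw [Fin.lt_def] at h1 h2
  rcases h.eq_fst_or_eq_snd ⟨2 * m + 1, by omega⟩ with e | e
  · have := congrArg Fin.val e; simp only at this; omega
  · have := congrArg Fin.val e; simp only at this; omega

end IsCanonicalWith

/-- A canonical word starts with the least letter and ends with the greatest, so `σ ∘ c` and `σ`
have the same end letters and rotation changes their descents equally. -/
theorem des_comp_add_des_rotate {m : ℕ} (σ : Equiv.Perm (Fin (m + 1)))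
    {c : Fin (2 * (m + 1)) → Fin (m + 1)} (hc : c ∈ canonicalWords (m + 1)) :
    des (⇑(Equiv.addRight 1 * σ : Equiv.Perm (Fin (m + 1))) ∘ c) + des (fun i => σ i) =
      des (⇑σ ∘ c) + des (fun i => (Equiv.addRight 1 * σ : Equiv.Perm (Fin (m + 1))) i) := by
  obtain ⟨p, q, h⟩ := mem_canonicalWords.1 hc
  have h1 := des_sub_des_rotate (l := 2 * m + 1) (⇑σ ∘ c)
  have h2 := des_sub_des_rotate (l := m) σ
  have h0 : (⇑σ ∘ c) (0 : Fin (2 * m + 1 + 1)) = σ 0 := congrArg σ h.apply_zero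
  have hl : (⇑σ ∘ c) (Fin.last (2 * m + 1)) = σ (Fin.last m) := congrArg σ h.apply_last
  rw [h0, hl, ← h2] at h1
  have h3 : (des (⇑σ ∘ c) : ℤ) - des (⇑(Equiv.addRight 1 * σ : Equiv.Perm (Fin (m + 1))) ∘ c) =
      des (fun i => σ i) - des (fun i => (Equiv.addRight 1 * σ : Equiv.Perm (Fin (m + 1))) i) := h1
  omega

/-! ### The relation between fibers and its invariance under rotation. -/

/-- The distributions of descents and plateaus over the words whose letters first occur in the
orders `σ` and `τ` agree up to a shift by the descents of `σ` and `τ`. -/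
def FiberEquiv {n : ℕ} (σ τ : Equiv.Perm (Fin n)) : Prop :=
  (MvPolynomial.X 0 : MvPolynomial (Fin 2) ℤ) ^ des (fun i => τ i) * fiberPoly σ =
    MvPolynomial.X 0 ^ des (fun i => σ i) * fiberPoly τ

theorem fiberEquiv_equivalence (n : ℕ) : Equivalence (FiberEquiv (n := n)) where
  refl _ := rfl
  symm h := h.symm
  trans {σ τ ρ} h1 h2 := by
    have h0 : (MvPolynomial.X 0 : MvPolynomial (Fin 2) ℤ) ^ des (fun i => τ i) ≠ 0 :=
      pow_ne_zero _ (MvPolynomial.X_ne_zero 0)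
    -- The power belonging to the middle permutation is nonzero in a domain, so it can be cancelled.
    refine mul_left_cancel₀ h0 ?_
    unfold FiberEquiv at h1 h2
    linear_combination (MvPolynomial.X 0 : MvPolynomial (Fin 2) ℤ) ^ des (fun i => ρ i) * h1 +
      (MvPolynomial.X 0 : MvPolynomial (Fin 2) ℤ) ^ des (fun i => σ i) * h2

theorem fiberEquiv_rotate {m : ℕ} (σ : Equiv.Perm (Fin (m + 1))) :
    FiberEquiv σ (Equiv.addRight 1 * σ) := by
  rw [FiberEquiv, fiberPoly, fiberPoly, Finset.mul_sum, Finset.mul_sum]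
  refine Finset.sum_congr rfl fun c hc => ?_
  have h1 : plat (⇑(Equiv.addRight 1 * σ : Equiv.Perm (Fin (m + 1))) ∘ c) = plat (⇑σ ∘ c) :=
    (plat_comp_injective c (Equiv.injective _)).trans (plat_comp_injective c σ.injective).symm
  rw [← mul_assoc, ← mul_assoc, ← pow_add, ← pow_add, h1, add_comm (des _),
    ← des_comp_add_des_rotate σ hc, add_comm (des _)]

/-! ### The exchange involution and invariance under swaps. -/

/-- `c` has the letters `a` and `b` at the adjacent positions `k` and `l = k + 1`. -/
def MeetAt {n : ℕ} (c : Fin (2 * n) → Fin n) (a b : Fin n) (k l : Fin (2 * n)) : Prop :=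
  l.val = k.val + 1 ∧ (c k = a ∧ c l = b ∨ c k = b ∧ c l = a)

namespace IsCanonicalWith

variable {n : ℕ} {c : Fin (2 * n) → Fin n} {p q : Fin n → Fin (2 * n)} {a b : Fin n}
  {k l : Fin (2 * n)}

/-- The letter `d = a + 1` lies strictly between `a` and `b`, and its occurrences separate every
other pair of copies of `a` and `b`. -/
theorem meetAt_eq (h : IsCanonicalWith c p q) (hab : a.val + 1 < b.val) (hm : MeetAt c a b k l) :
    k = q a ∧ l = p b ∨ k = p b ∧ l = q a := by
  obtain ⟨hkl, hm⟩ := hm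
  set d : Fin n := ⟨a.val + 1, by omega⟩
  have had : a < d := Fin.lt_def.2 (by simp [d])
  have hdb : d < b := Fin.lt_def.2 hab
  have h1 := Fin.lt_def.1 (h.strictMono_fst had)
  have h2 := Fin.lt_def.1 (h.strictMono_fst hdb)
  have h3 := Fin.lt_def.1 (h.strictMono_snd had)
  have h4 := Fin.lt_def.1 (h.strictMono_snd hdb)
  have h5 := Fin.lt_def.1 (h.lt a)
  have h6 := Fin.lt_def.1 (h.lt b)
  rw [h.apply_eq_iff, h.apply_eq_iff, h.apply_eq_iff, h.apply_eq_iff] at hm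
  simp only [Fin.ext_iff] at hm ⊢
  omega

theorem meetAt_next_ne (h : IsCanonicalWith c p q) (hab : a.val + 1 < b.val)
    (hm : MeetAt c a b k l) {i : Fin (2 * n)} (hi : i.val = l.val + 1 ∨ i.val + 1 = k.val) :
    c i ≠ a ∧ c i ≠ b := by
  have hkl := hm.1
  have he := h.meetAt_eq hab hm
  set d : Fin n := ⟨a.val + 1, by omega⟩
  have had : a < d := Fin.lt_def.2 (by simp [d])
  have hdb : d < b := Fin.lt_def.2 hab
  have h1 := Fin.lt_def.1 (h.strictMono_fst had)
  have h2 := Fin.lt_def.1 (h.strictMono_fst hdb)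
  have h3 := Fin.lt_def.1 (h.strictMono_snd had)
  have h4 := Fin.lt_def.1 (h.strictMono_snd hdb)
  have h5 := Fin.lt_def.1 (h.lt a)
  have h6 := Fin.lt_def.1 (h.lt b)
  -- When `k = q a` and `l = p b`, these force `p d < k` and `l < q d`, so a copy of `d` keeps the
  -- other copies of `a` and `b` away from the meeting place.
  have h7 := h.fst_ne_snd b d
  have h8 := h.fst_ne_snd d a
  rw [Ne, Ne, h.apply_eq_iff, h.apply_eq_iff]
  simp only [Fin.ext_iff, Ne] at he h7 h8 ⊢
  omega

theorem meetAt_unique (h : IsCanonicalWith c p q) (hab : a.val + 1 < b.val)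
    (hm : MeetAt c a b k l) {k' l' : Fin (2 * n)} (hm' : MeetAt c a b k' l') :
    k' = k ∧ l' = l := by
  have h1 := h.meetAt_eq hab hm
  have h2 := h.meetAt_eq hab hm'
  have h3 := hm.1
  have h4 := hm'.1
  simp only [Fin.ext_iff] at h1 h2 ⊢
  omega

/-- Transposing adjacent positions reverses only the order of `k` and `l`, and these hold a first
and a second occurrence of different letters, a pair that no canonicity condition compares. -/
theorem comp_swap (h : IsCanonicalWith c p q) (hab : a.val + 1 < b.val)
    (hm : MeetAt c a b k l) :
    IsCanonicalWith (c ∘ Equiv.swap k l) (Equiv.swap k l ∘ p) (Equiv.swap k l ∘ q) := by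
  have he := h.meetAt_eq hab hm
  have hkl := hm.1
  have hlt : ∀ i j : Fin (2 * n), i < j → ¬ (i = k ∧ j = l) →
      Equiv.swap k l i < Equiv.swap k l j := by
    intro i j hij hne
    simp only [Equiv.swap_apply_def, Fin.ext_iff, Fin.lt_def] at *
    split_ifs <;> omega
  refine ⟨fun x y hxy => hlt _ _ (h.strictMono_fst hxy) ?_,
    fun x y hxy => hlt _ _ (h.strictMono_snd hxy) ?_, fun x => hlt _ _ (h.lt x) ?_,
    fun x => by simp [h.apply_fst], fun x => by simp [h.apply_snd]⟩
  · rintro ⟨h1, h2⟩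
    rcases he with ⟨h3, h4⟩ | ⟨h3, h4⟩
    · exact h.fst_ne_snd _ _ (h1.trans h3)
    · exact h.fst_ne_snd _ _ (h2.trans h4)
  · rintro ⟨h1, h2⟩
    rcases he with ⟨h3, h4⟩ | ⟨h3, h4⟩
    · exact h.fst_ne_snd _ _ (h2.trans h4).symm
    · exact h.fst_ne_snd _ _ (h1.trans h3).symm
  · rintro ⟨h1, h2⟩
    rcases he with ⟨h3, h4⟩ | ⟨h3, h4⟩
    · exact h.fst_ne_snd _ _ (h1.trans h3)
    · have h5 := h.strictMono_fst.injective (h1.trans h3)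
      have h6 := h.strictMono_snd.injective (h2.trans h4)
      rw [← h5, ← h6] at hab
      omega

end IsCanonicalWith

theorem MeetAt.comp_swap {n : ℕ} {c : Fin (2 * n) → Fin n} {a b : Fin n} {k l : Fin (2 * n)}
    (h : MeetAt c a b k l) : MeetAt (c ∘ Equiv.swap k l) a b k l := by
  refine ⟨h.1, ?_⟩
  have := h.2
  simp only [Function.comp_apply, Equiv.swap_apply_left, Equiv.swap_apply_right]
  tauto

open Classical in
/-- Exchange the letters `a` and `b` of `c` if they occur at adjacent positions. -/
noncomputable def exchange {n : ℕ} (a b : Fin n) (c : Fin (2 * n) → Fin n) :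
    Fin (2 * n) → Fin n :=
  if h : ∃ kl : Fin (2 * n) × Fin (2 * n), MeetAt c a b kl.1 kl.2 then
    c ∘ Equiv.swap h.choose.1 h.choose.2
  else c

/-- The meeting place is unique, so the choice made in `exchange` is immaterial. -/
theorem IsCanonicalWith.exchange_eq {n : ℕ} {c : Fin (2 * n) → Fin n} {p q : Fin n → Fin (2 * n)}
    {a b : Fin n} {k l : Fin (2 * n)} (h : IsCanonicalWith c p q) (hab : a.val + 1 < b.val)
    (hm : MeetAt c a b k l) : exchange a b c = c ∘ Equiv.swap k l := by
  have hex : ∃ kl : Fin (2 * n) × Fin (2 * n), MeetAt c a b kl.1 kl.2 := ⟨(k, l), hm⟩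
  obtain ⟨h1, h2⟩ := h.meetAt_unique hab hm hex.choose_spec
  rw [exchange, dif_pos hex, h1, h2]

theorem exchange_eq_self {n : ℕ} {c : Fin (2 * n) → Fin n} {a b : Fin n}
    (h : ∀ k l, ¬ MeetAt c a b k l) : exchange a b c = c := by
  rw [exchange, dif_neg]
  rintro ⟨kl, hkl⟩
  exact h _ _ hkl

theorem exchange_mem {n : ℕ} {c : Fin (2 * n) → Fin n} {a b : Fin n} (hab : a.val + 1 < b.val)
    (hc : c ∈ canonicalWords n) : exchange a b c ∈ canonicalWords n := by
  obtain ⟨p, q, h⟩ := mem_canonicalWords.1 hc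
  by_cases hm : ∃ k l, MeetAt c a b k l
  · obtain ⟨k, l, hm⟩ := hm
    rw [h.exchange_eq hab hm]
    exact mem_canonicalWords.2 ⟨_, _, h.comp_swap hab hm⟩
  · push Not at hm
    rwa [exchange_eq_self hm]

theorem exchange_exchange {n : ℕ} {c : Fin (2 * n) → Fin n} {a b : Fin n}
    (hab : a.val + 1 < b.val) (hc : c ∈ canonicalWords n) :
    exchange a b (exchange a b c) = c := by
  obtain ⟨p, q, h⟩ := mem_canonicalWords.1 hc
  by_cases hm : ∃ k l, MeetAt c a b k l
  · obtain ⟨k, l, hm⟩ := hm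
    rw [h.exchange_eq hab hm, (h.comp_swap hab hm).exchange_eq hab hm.comp_swap]
    funext i
    simp
  · push Not at hm
    rw [exchange_eq_self hm, exchange_eq_self hm]

theorem swap_lt_iff {n : ℕ} {u v x y : Fin n} (huv : v.val = u.val + 1)
    (h : ¬ ((x = u ∧ y = v) ∨ (x = v ∧ y = u))) :
    Equiv.swap u v x < Equiv.swap u v y ↔ x < y := by
  simp only [Equiv.swap_apply_def, Fin.ext_iff, Fin.lt_def] at *
  split_ifs <;> omega

theorem des_congr {l n : ℕ} {w w' : Fin l → Fin n}
    (h : ∀ i j : Fin l, j.val = i.val + 1 → (w' j < w' i ↔ w j < w i)) : des w' = des w := by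
  unfold des
  congr 1
  ext i
  simp only [Finset.mem_filter, Finset.mem_univ, true_and]
  exact exists_congr fun hi => h i ⟨i.val + 1, hi⟩ rfl

theorem plat_congr {l n : ℕ} {w w' : Fin l → Fin n}
    (h : ∀ i j : Fin l, j.val = i.val + 1 → (w' i = w' j ↔ w i = w j)) : plat w' = plat w := by
  unfold plat
  congr 1
  ext i
  simp only [Finset.mem_filter, Finset.mem_univ, true_and]
  exact exists_congr fun hi => h i ⟨i.val + 1, hi⟩ rfl

theorem des_comp_swap {n : ℕ} {σ : Equiv.Perm (Fin n)} {a b : Fin n} (hab : a.val + 1 < b.val)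
    (hσ : (σ b).val = (σ a).val + 1) : des (fun i => (σ * Equiv.swap a b) i) = des fun i => σ i := by
  refine des_congr fun i j hij => ?_
  rw [Equiv.mul_swap_eq_swap_mul, Equiv.Perm.mul_apply, Equiv.Perm.mul_apply]
  refine swap_lt_iff hσ ?_
  simp only [σ.injective.eq_iff, Fin.ext_iff]
  omega

/-- At the meeting place the exchange of letters and the relabelling by `swap a b` cancel; elsewhere
only the relabelling acts. -/
theorem comp_exchange_apply {n : ℕ} {σ : Equiv.Perm (Fin n)} {a b : Fin n} {c : Fin (2 * n) → Fin n}
    {p q : Fin n → Fin (2 * n)} {k l : Fin (2 * n)} (h : IsCanonicalWith c p q)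
    (hab : a.val + 1 < b.val) (hm : MeetAt c a b k l) (i : Fin (2 * n)) :
    σ (Equiv.swap a b (exchange a b c i)) =
      if i = k ∨ i = l then σ (c i) else σ (Equiv.swap a b (c i)) := by
  rw [h.exchange_eq hab hm, Function.comp_apply]
  by_cases hk : i = k
  · subst hk
    rcases hm.2 with ⟨h1, h2⟩ | ⟨h1, h2⟩ <;> simp [h1, h2]
  by_cases hl : i = l
  · subst hl
    rcases hm.2 with ⟨h1, h2⟩ | ⟨h1, h2⟩ <;> simp [h1, h2]
  rw [Equiv.swap_apply_of_ne_of_ne hk hl, if_neg (by tauto)]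

/-- Relabelling by two consecutive values affects only comparisons of these values with each other.
Such adjacent letters occur only at the meeting place, where the word is unchanged; and next to that
place the letters are neither `a` nor `b`. -/
theorem exchange_compare {n : ℕ} {σ : Equiv.Perm (Fin n)} {a b : Fin n} (hab : a.val + 1 < b.val)
    (hσ : (σ b).val = (σ a).val + 1) {c : Fin (2 * n) → Fin n} (hc : c ∈ canonicalWords n)
    (i j : Fin (2 * n)) (hij : j.val = i.val + 1) :
    let w := fun i => σ (c i)
    let w' := fun i => σ (Equiv.swap a b (exchange a b c i))
    (w' j < w' i ↔ w j < w i) ∧ (w' i < w' j ↔ w i < w j) := by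
  intro w w'
  obtain ⟨p, q, h⟩ := mem_canonicalWords.1 hc
  have hswap : ∀ x, σ (Equiv.swap a b x) = Equiv.swap (σ a) (σ b) (σ x) := fun x => by
    rw [← Equiv.Perm.mul_apply, Equiv.mul_swap_eq_swap_mul, Equiv.Perm.mul_apply]
  by_cases hm : ∃ k l, MeetAt c a b k l
  · obtain ⟨k, l, hm⟩ := hm
    have hw : ∀ i, w' i = if i = k ∨ i = l then w i else Equiv.swap (σ a) (σ b) (w i) := fun i => by
      simp only [w', w]
      rw [comp_exchange_apply h hab hm, hswap]
    have hkl := hm.1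
    by_cases hi : i = k ∨ i = l <;> by_cases hj : j = k ∨ j = l
    · simp only [hw, if_pos hi, if_pos hj, and_self]
    · have hjl : j.val = l.val + 1 := by
        simp only [Fin.ext_iff] at hi hj
        omega
      obtain ⟨h1, h2⟩ := h.meetAt_next_ne hab hm (Or.inl hjl)
      rw [hw, hw, if_pos hi, if_neg hj,
        Equiv.swap_apply_of_ne_of_ne (σ.injective.ne h1) (σ.injective.ne h2)]
      exact ⟨Iff.rfl, Iff.rfl⟩
    · have hik : i.val + 1 = k.val := by
        simp only [Fin.ext_iff] at hi hj
        omega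
      obtain ⟨h1, h2⟩ := h.meetAt_next_ne hab hm (Or.inr hik)
      rw [hw, hw, if_pos hj, if_neg hi,
        Equiv.swap_apply_of_ne_of_ne (σ.injective.ne h1) (σ.injective.ne h2)]
      exact ⟨Iff.rfl, Iff.rfl⟩
    · rw [hw, hw, if_neg hi, if_neg hj]
      have hne : ¬ MeetAt c a b i j := fun hm' => hi (Or.inl (h.meetAt_unique hab hm hm').1)
      constructor <;> refine swap_lt_iff hσ ?_ <;> simp only [w, σ.injective.eq_iff] <;>
        intro h' <;> exact hne ⟨hij, by tauto⟩
  · push Not at hm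
    simp only [w', w, exchange_eq_self hm, hswap]
    have hne := hm i j
    constructor <;> refine swap_lt_iff hσ ?_ <;> simp only [σ.injective.eq_iff] <;>
      intro h' <;> exact hne ⟨hij, by tauto⟩

theorem fiberPoly_mul_swap {n : ℕ} {σ : Equiv.Perm (Fin n)} {a b : Fin n}
    (hab : a.val + 1 < b.val) (hσ : (σ b).val = (σ a).val + 1) :
    fiberPoly (σ * Equiv.swap a b) = fiberPoly σ := by
  symm
  refine Finset.sum_nbij' (exchange a b) (exchange a b) (fun c hc => exchange_mem hab hc)
    (fun c hc => exchange_mem hab hc) (fun c hc => exchange_exchange hab hc)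
    (fun c hc => exchange_exchange hab hc) fun c hc => ?_
  have h1 : des (⇑(σ * Equiv.swap a b) ∘ exchange a b c) = des (⇑σ ∘ c) :=
    des_congr fun i j hij => (exchange_compare hab hσ hc i j hij).1
  have h2 : plat (⇑(σ * Equiv.swap a b) ∘ exchange a b c) = plat (⇑σ ∘ c) :=
    plat_congr fun i j hij => by
      have h3 := exchange_compare hab hσ hc i j hij
      have h4 : ∀ x y : Fin n, x = y ↔ ¬ y < x ∧ ¬ x < y := fun x y => by
        rw [Fin.ext_iff, Fin.lt_def, Fin.lt_def]; omega
      rw [h4, h4]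
      exact and_congr (not_congr h3.1) (not_congr h3.2)
  rw [h1, h2]

theorem fiberEquiv_swap_of_val {n : ℕ} {σ : Equiv.Perm (Fin n)} {a b : Fin n}
    (hab : a.val + 1 < b.val) (hσ : (σ b).val = (σ a).val + 1) :
    FiberEquiv σ (σ * Equiv.swap a b) := by
  rw [FiberEquiv, des_comp_swap hab hσ, fiberPoly_mul_swap hab hσ]

theorem fiberEquiv_swap {m : ℕ} {σ : Equiv.Perm (Fin (m + 1))} {a b : Fin (m + 1)}
    (hab : a.val + 1 < b.val) (hσ : σ b = σ a + 1) :
    FiberEquiv σ (σ * Equiv.swap a b) := by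
  have he := fiberEquiv_equivalence (m + 1)
  by_cases hlast : σ a = Fin.last m
  -- The two values are the greatest and 0. One rotation turns them into 0 and 1, which are
  -- consecutive without wrapping; it is undone after the swap.
  · refine he.trans (fiberEquiv_rotate σ) (he.trans (fiberEquiv_swap_of_val hab ?_)
      (he.symm (fiberEquiv_rotate (σ * Equiv.swap a b))))
    have h0 : (0 : Fin (m + 1)) < Fin.last m := Fin.lt_def.2 (by simp; omega)
    simp only [Equiv.Perm.mul_apply, Equiv.coe_addRight]
    rw [hσ, hlast, Fin.last_add_one, Fin.val_add_one_of_lt h0]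
  · refine fiberEquiv_swap_of_val hab ?_
    rw [hσ, Fin.val_add_one_of_lt (Fin.lt_last_iff_ne_last.2 hlast)]

theorem isRotationSwapInvariant_fiberEquiv (m : ℕ) :
    IsRotationSwapInvariant (FiberEquiv (n := m + 1)) where
  equiv := fiberEquiv_equivalence _
  rotate := fiberEquiv_rotate
  swap _ _ _ hab hσ := fiberEquiv_swap hab hσ

theorem des_id (n : ℕ) : des (fun i : Fin n => i) = 0 := by
  rw [des, Finset.card_eq_zero, Finset.filter_eq_empty_iff]
  rintro i - ⟨h, hlt⟩
  rw [Fin.lt_def] at hlt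
  simp at hlt

theorem fiberPoly_eq {m : ℕ} (σ : Equiv.Perm (Fin (m + 1))) :
    fiberPoly σ = MvPolynomial.X 0 ^ des (fun i => σ i) * fiberPoly (1 : Equiv.Perm (Fin (m + 1))) := by
  have h := (isRotationSwapInvariant_fiberEquiv m).rel_one σ
  rw [FiberEquiv] at h
  simpa only [Equiv.Perm.one_apply, des_id, pow_zero, one_mul] using h

/-! ### Counting steps of Dyck paths. -/

theorem count_take_eq_natCount {α : Type*} [DecidableEq α] (l : List α) (s : α) (k : ℕ) :
    (l.take k).count s = Nat.count (fun m => l[m]? = some s) k := by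
  induction k with
  | zero => simp
  | succ k ih =>
    rw [Nat.count_succ, List.take_add_one, List.count_append, ih]
    cases h : l[k]? with
    | none => simp
    | some t => simp [List.count_cons]

theorem exists_count_eq_of_lt_count {P : ℕ → Prop} [DecidablePred P] {x N : ℕ}
    (h : x < Nat.count P N) : ∃ k < N, P k ∧ Nat.count P k = x := by
  induction N with
  | zero => simp at h
  | succ N ih =>
    by_cases hx : x < Nat.count P N
    · obtain ⟨k, h1, h2⟩ := ih hx
      exact ⟨k, by omega, h2⟩
    · rw [Nat.count_succ] at h
      split_ifs at h with hP
      · exact ⟨N, by omega, hP, by omega⟩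
      · omega

theorem natCount_range_eq_card {n N : ℕ} (p : Fin n → Fin N) (hp : Function.Injective p)
    {P : ℕ → Prop} [DecidablePred P] (hP : ∀ k, P k ↔ ∃ x, (p x).val = k) (k : ℕ) :
    Nat.count P k = (Finset.univ.filter fun x => (p x).val < k).card := by
  rw [Nat.count_eq_card_filter_range]
  symm
  refine Finset.card_nbij (fun x => (p x).val) (fun x hx => ?_)
    (fun x _ y _ h => hp (Fin.ext h)) fun i hi => ?_
  · simp only [Finset.coe_filter, Finset.mem_univ, true_and, Set.mem_ofPred_eq,
      Finset.mem_range] at hx ⊢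
    exact ⟨hx, (hP _).2 ⟨x, rfl⟩⟩
  · simp only [Finset.coe_filter, Finset.mem_range, Set.mem_ofPred_eq] at hi
    obtain ⟨x, rfl⟩ := (hP _).1 hi.2
    exact ⟨x, by simpa using hi.1, rfl⟩

theorem natCount_apply_of_strictMono {n N : ℕ} (p : Fin n → Fin N) (hp : StrictMono p)
    {P : ℕ → Prop} [DecidablePred P] (hP : ∀ k, P k ↔ ∃ x, (p x).val = k) (x : Fin n) :
    Nat.count P (p x).val = x.val := by
  rw [natCount_range_eq_card p hp.injective hP]
  simp only [← Fin.lt_def, hp.lt_iff_lt]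
  rw [Finset.filter_gt_eq_Iio, Fin.card_Iio]

namespace DyckWord

/-- The number of steps `s` among the first `k` steps of `p`. -/
abbrev countTake (p : DyckWord) (s : DyckStep) (k : ℕ) : ℕ := (p.toList.take k).count s

variable (p : DyckWord)

theorem countTake_mono (s : DyckStep) : Monotone (p.countTake s) := by
  intro i j hij
  simp only [countTake, count_take_eq_natCount]
  exact Nat.count_monotone _ hij

theorem countTake_succ {s : DyckStep} {k : ℕ} (h : p.toList[k]? = some s) :
    p.countTake s (k + 1) = p.countTake s k + 1 := by
  simp only [countTake, count_take_eq_natCount]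
  rw [Nat.count_succ, if_pos h]

theorem countTake_succ_of_ne {s : DyckStep} {k : ℕ} (h : p.toList[k]? ≠ some s) :
    p.countTake s (k + 1) = p.countTake s k := by
  simp only [countTake, count_take_eq_natCount]
  rw [Nat.count_succ, if_neg h, add_zero]

theorem countTake_two_mul_semilength (s : DyckStep) :
    p.countTake s (2 * p.semilength) = p.semilength := by
  rw [countTake, two_mul_semilength_eq_length, List.take_length]
  cases s
  · rfl
  · exact p.semilength_eq_count_D.symm

theorem getElem?_eq_U_or_D {k : ℕ} (h : k < 2 * p.semilength) :
    p.toList[k]? = some DyckStep.U ∨ p.toList[k]? = some DyckStep.D := by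
  rw [two_mul_semilength_eq_length] at h
  rw [List.getElem?_eq_getElem h]
  simpa using DyckStep.dichotomy _

theorem countTake_lt {s : DyckStep} {k : ℕ} (h : p.toList[k]? = some s) :
    p.countTake s k < p.semilength := by
  have hk : k < 2 * p.semilength := by
    rw [two_mul_semilength_eq_length]
    exact (List.getElem?_eq_some_iff.1 h).1
  have h1 := p.countTake_mono s (Nat.succ_le_of_lt hk)
  rw [countTake_two_mul_semilength, Nat.succ_eq_add_one, p.countTake_succ h] at h1
  omega

theorem exists_countTake_eq (s : DyckStep) {x : ℕ} (h : x < p.semilength) :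
    ∃ k < 2 * p.semilength, p.toList[k]? = some s ∧ p.countTake s k = x := by
  rw [← p.countTake_two_mul_semilength s, countTake, count_take_eq_natCount] at h
  simp only [countTake, count_take_eq_natCount]
  exact exists_count_eq_of_lt_count h

/-- The letter of the canonical word of `p` at the position `k`. -/
def letter (k : ℕ) : ℕ :=
  if p.toList[k]? = some DyckStep.U then p.countTake DyckStep.U k else p.countTake DyckStep.D k

theorem letter_of_U {k : ℕ} (h : p.toList[k]? = some DyckStep.U) :
    p.letter k = p.countTake DyckStep.U k := if_pos h

theorem letter_of_D {k : ℕ} (h : p.toList[k]? = some DyckStep.D) :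
    p.letter k = p.countTake DyckStep.D k := if_neg (by simp [h])

theorem letter_lt {k : ℕ} (h : k < 2 * p.semilength) : p.letter k < p.semilength := by
  rcases p.getElem?_eq_U_or_D h with h | h
  · rw [p.letter_of_U h]
    exact p.countTake_lt h
  · rw [p.letter_of_D h]
    exact p.countTake_lt h

end DyckWord

/-! ### The bijection between Dyck paths and canonical words. -/

/-- The word whose first occurrences of `0, 1, …` are at the east steps of `p` and whose second
occurrences are at the north steps. -/
def canonicalWord {n : ℕ} (p : {p : DyckWord // p.semilength = n}) (i : Fin (2 * n)) : Fin n :=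
  ⟨p.1.letter i, by
    have := p.1.letter_lt (k := i) (by rw [p.2]; exact i.2)
    rwa [p.2] at this⟩

/-- The positions `p x` and `q x` are those of the east and north steps preceded by exactly `x`
steps of the same kind. The second clause lets the path be recovered from its word. -/
theorem exists_isCanonicalWith_canonicalWord {n : ℕ} (D : {p : DyckWord // p.semilength = n}) :
    ∃ p q, IsCanonicalWith (canonicalWord D) p q ∧
      ∀ i, D.1.toList[i.val]? = some DyckStep.U ↔ ∃ x, p x = i := by
  obtain ⟨D, rfl⟩ := D
  have hU := fun x : Fin D.semilength => D.exists_countTake_eq DyckStep.U x.2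
  have hD := fun x : Fin D.semilength => D.exists_countTake_eq DyckStep.D x.2
  choose p hp hpU hpc using hU
  choose q hq hqD hqc using hD
  have hpm : ∀ x y, x < y → p x < p y := by
    intro x y hxy
    by_contra h
    have := D.countTake_mono DyckStep.U (not_lt.1 h)
    rw [hpc, hpc] at this
    exact absurd (Fin.le_def.2 this) hxy.not_ge
  have hqm : ∀ x y, x < y → q x < q y := by
    intro x y hxy
    by_contra h
    have := D.countTake_mono DyckStep.D (not_lt.1 h)
    rw [hqc, hqc] at this
    exact absurd (Fin.le_def.2 this) hxy.not_ge
  have hpq : ∀ x, p x < q x := by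
    intro x
    by_contra h
    rcases (not_lt.1 h).eq_or_lt with h | h
    · have := hqD x
      rw [h, hpU] at this
      simp at this
    -- If `q x < p x`, the first `q x + 1` steps contain `x + 1` north steps but at most `x` east
    -- steps.
    · have h1 := D.countTake_mono DyckStep.U (Nat.succ_le_of_lt h)
      have h2 := D.count_D_le_count_U (q x + 1)
      have h3 := D.countTake_succ (hqD x)
      rw [hqc] at h3
      rw [hpc] at h1
      simp only [DyckWord.countTake, Nat.succ_eq_add_one] at h1 h3
      omega
  have hcan : IsCanonicalWith (canonicalWord ⟨D, rfl⟩) (fun x => ⟨p x, hp x⟩)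
      (fun x => ⟨q x, hq x⟩) :=
    ⟨fun x y h => Fin.lt_def.2 (hpm x y h), fun x y h => Fin.lt_def.2 (hqm x y h),
      fun x => Fin.lt_def.2 (hpq x),
      fun x => Fin.ext ((D.letter_of_U (hpU x)).trans (hpc x)),
      fun x => Fin.ext ((D.letter_of_D (hqD x)).trans (hqc x))⟩
  refine ⟨_, _, hcan, fun i => ⟨fun h => ?_, ?_⟩⟩
  · rcases hcan.eq_fst_or_eq_snd i with e | e
    · exact ⟨_, e.symm⟩
    · rw [e] at h
      simp only at h
      rw [hqD] at h
      simp at h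
  · rintro ⟨x, rfl⟩
    exact hpU x

theorem canonicalWord_injective (n : ℕ) : Function.Injective (canonicalWord (n := n)) := by
  intro D D' h
  obtain ⟨p, q, hc, hp⟩ := exists_isCanonicalWith_canonicalWord D
  obtain ⟨p', q', hc', hp'⟩ := exists_isCanonicalWith_canonicalWord D'
  have hpp : ∀ x, p x = p' x := fun x => hc.fst_snd_unique hc' (τ := 1) (by rw [h]; rfl) x
  have hl : D.1.toList.length = 2 * n := by
    rw [← DyckWord.two_mul_semilength_eq_length, D.2]
  have hl' : D'.1.toList.length = 2 * n := by
    rw [← DyckWord.two_mul_semilength_eq_length, D'.2]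
  refine Subtype.ext (DyckWord.ext (List.ext_getElem (hl.trans hl'.symm) fun i h1 h2 => ?_))
  have hi : i < 2 * n := hl ▸ h1
  have hU : D.1.toList[i]? = some DyckStep.U ↔ D'.1.toList[i]? = some DyckStep.U := by
    rw [hp ⟨i, hi⟩, hp' ⟨i, hi⟩]
    simp only [hpp]
  rw [List.getElem?_eq_getElem h1, List.getElem?_eq_getElem h2, Option.some_inj,
    Option.some_inj] at hU
  rcases DyckStep.dichotomy D.1.toList[i] with e | e
  · rw [e, hU.1 e]
  · rcases DyckStep.dichotomy D'.1.toList[i] with e' | e'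
    · rw [e', hU.2 e']
    · rw [e, e']

theorem exists_canonicalWord_eq {n : ℕ} {c : Fin (2 * n) → Fin n} (hc : c ∈ canonicalWords n) :
    ∃ D, canonicalWord D = c := by
  classical
  obtain ⟨p, q, h⟩ := mem_canonicalWords.1 hc
  set l : List DyckStep :=
    List.ofFn fun i => if ∃ x, p x = i then DyckStep.U else DyckStep.D with hl
  have hlen : l.length = 2 * n := by simp [hl]
  have hget : ∀ (i : ℕ) (hi : i < 2 * n),
      l[i]? = some (if ∃ x, p x = ⟨i, hi⟩ then DyckStep.U else DyckStep.D) := by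
    intro i hi
    rw [List.getElem?_eq_getElem (by omega)]
    simp [hl]
  have hU : ∀ k, l[k]? = some DyckStep.U ↔ ∃ x, (p x).val = k := by
    intro k
    by_cases hk : k < 2 * n
    · rw [hget k hk]
      simp only [Fin.ext_iff]
      split_ifs with h' <;> simp [h']
    · rw [List.getElem?_eq_none (by omega)]
      simp only [reduceCtorEq, false_iff, not_exists]
      intro x hx
      exact hk (hx ▸ (p x).2)
  have hD : ∀ k, l[k]? = some DyckStep.D ↔ ∃ x, (q x).val = k := by
    intro k
    by_cases hk : k < 2 * n
    · rw [hget k hk]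
      have h1 := h.eq_fst_or_eq_snd ⟨k, hk⟩
      split_ifs with h'
      · obtain ⟨x, hx⟩ := h'
        simp only [Option.some_inj, reduceCtorEq, false_iff, not_exists]
        intro y hy
        exact h.fst_ne_snd x y (hx.trans (Fin.ext hy.symm))
      · simp only [true_iff]
        rcases h1 with h1 | h1
        · exact absurd ⟨_, h1.symm⟩ h'
        · exact ⟨_, (congrArg Fin.val h1).symm⟩
    · rw [List.getElem?_eq_none (by omega)]
      simp only [reduceCtorEq, false_iff, not_exists]
      intro x hx
      exact hk (hx ▸ (q x).2)
  have hcU : ∀ k, (l.take k).count DyckStep.U =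
      (Finset.univ.filter fun x => (p x).val < k).card := fun k => by
    rw [count_take_eq_natCount, natCount_range_eq_card p h.strictMono_fst.injective hU]
  have hcD : ∀ k, (l.take k).count DyckStep.D =
      (Finset.univ.filter fun x => (q x).val < k).card := fun k => by
    rw [count_take_eq_natCount, natCount_range_eq_card q h.strictMono_snd.injective hD]
  have htU : l.count DyckStep.U = n := by
    have := hcU (2 * n)
    rw [List.take_of_length_le hlen.le] at this
    simpa using this
  have htD : l.count DyckStep.D = n := by
    have := hcD (2 * n)
    rw [List.take_of_length_le hlen.le] at this
    simpa using this
  -- The path stays weakly below the diagonal because a letter already seen twice in a prefix has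
  -- its first occurrence there.
  let D : DyckWord := ⟨l, htU.trans htD.symm, fun k => by
    rw [hcU, hcD]
    refine Finset.card_le_card fun x hx => ?_
    simp only [Finset.mem_filter, Finset.mem_univ, true_and] at hx ⊢
    exact (Fin.lt_def.1 (h.lt x)).trans hx⟩
  refine ⟨⟨D, htU⟩, funext fun i => Fin.ext ?_⟩
  change D.letter i = _
  rcases h.eq_fst_or_eq_snd i with e | e
  · rw [D.letter_of_U ((hU i).2 ⟨_, (congrArg Fin.val e).symm⟩)]
    rw [DyckWord.countTake, count_take_eq_natCount]
    conv_lhs => rw [e]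
    exact natCount_apply_of_strictMono p h.strictMono_fst hU _
  · rw [D.letter_of_D ((hD i).2 ⟨_, (congrArg Fin.val e).symm⟩)]
    rw [DyckWord.countTake, count_take_eq_natCount]
    conv_lhs => rw [e]
    exact natCount_apply_of_strictMono q h.strictMono_snd hD _

/-! ### Descents and plateaus as high and low peaks. -/

namespace DyckWord

variable (p : DyckWord)

/-- Letters count earlier steps of the same kind, so they rise by 1 along equal steps and do not
fall from a north to an east step. At a peak the comparison is between the numbers of north and east
steps so far, which differ exactly off the diagonal. -/
theorem letter_succ_lt_iff {i : ℕ} (h : i + 1 < 2 * p.semilength) :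
    p.letter (i + 1) < p.letter i ↔ IsPeakAt p i ∧ ¬ OnDiagonal p i := by
  have hle : p.countTake DyckStep.D i ≤ p.countTake DyckStep.U i := p.count_D_le_count_U i
  unfold IsPeakAt OnDiagonal
  change _ ↔ _ ∧ ¬ p.countTake DyckStep.U i = p.countTake DyckStep.D i
  rcases p.getElem?_eq_U_or_D (show i < 2 * p.semilength by omega) with h1 | h1 <;>
    rcases p.getElem?_eq_U_or_D h with h2 | h2
  · rw [p.letter_of_U h1, p.letter_of_U h2, p.countTake_succ h1]
    simp [h2]
  · rw [p.letter_of_U h1, p.letter_of_D h2, p.countTake_succ_of_ne (by simp [h1])]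
    simp only [h1, h2, and_self, true_and]
    omega
  · rw [p.letter_of_D h1, p.letter_of_U h2, p.countTake_succ_of_ne (by simp [h1])]
    simp only [h1, h2, Option.some_inj, reduceCtorEq, false_and, iff_false]
    omega
  · rw [p.letter_of_D h1, p.letter_of_D h2, p.countTake_succ h1]
    simp [h1]

theorem letter_eq_succ_iff {i : ℕ} (h : i + 1 < 2 * p.semilength) :
    p.letter i = p.letter (i + 1) ↔ IsPeakAt p i ∧ OnDiagonal p i := by
  -- The bound is taken after step `i`, not before it: for a north step followed by an east step it
  -- makes the rise strict, which excludes a plateau.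
  have hle := p.count_D_le_count_U (i + 1)
  unfold IsPeakAt OnDiagonal
  change _ ↔ _ ∧ p.countTake DyckStep.U i = p.countTake DyckStep.D i
  change p.countTake DyckStep.D (i + 1) ≤ p.countTake DyckStep.U (i + 1) at hle
  rcases p.getElem?_eq_U_or_D (show i < 2 * p.semilength by omega) with h1 | h1 <;>
    rcases p.getElem?_eq_U_or_D h with h2 | h2
  · rw [p.letter_of_U h1, p.letter_of_U h2, p.countTake_succ h1]
    simp [h2]
  · rw [p.letter_of_U h1, p.letter_of_D h2, p.countTake_succ_of_ne (by simp [h1])]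
    simp only [h1, h2, and_self, true_and]
  · rw [p.letter_of_D h1, p.letter_of_U h2]
    rw [p.countTake_succ h1] at hle
    simp only [h1, h2, Option.some_inj, reduceCtorEq, false_and, iff_false]
    omega
  · rw [p.letter_of_D h1, p.letter_of_D h2, p.countTake_succ h1]
    simp [h1]

theorem add_one_lt_of_isPeakAt {i : ℕ} (h : IsPeakAt p i) : i + 1 < 2 * p.semilength := by
  rw [two_mul_semilength_eq_length]
  exact (List.getElem?_eq_some_iff.1 h.2).1

end DyckWord

theorem card_filter_fin_eq_card_filter_range {N : ℕ} {P : Fin N → Prop} {Q : ℕ → Prop}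
    [DecidablePred P] [DecidablePred Q] (h : ∀ i, P i ↔ Q i.val) :
    (Finset.univ.filter P).card = ((Finset.range N).filter Q).card := by
  refine Finset.card_nbij Fin.val (fun i hi => ?_) (fun i _ j _ e => Fin.ext e) fun i hi => ?_
  · simpa [h] using hi
  · simp only [Finset.coe_filter, Finset.mem_range, Set.mem_ofPred_eq] at hi
    exact ⟨⟨i, hi.1⟩, by simpa [h] using hi.2, rfl⟩

theorem des_canonicalWord {n : ℕ} (D : {p : DyckWord // p.semilength = n}) :
    des (canonicalWord D) = highPeaks D.1 := by
  obtain ⟨D, rfl⟩ := D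
  rw [highPeaks, ← D.two_mul_semilength_eq_length, des]
  refine card_filter_fin_eq_card_filter_range fun i => ⟨?_, fun h => ?_⟩
  · rintro ⟨h, hlt⟩
    exact (D.letter_succ_lt_iff h).1 hlt
  · have hi := D.add_one_lt_of_isPeakAt h.1
    exact ⟨hi, (D.letter_succ_lt_iff hi).2 h⟩

theorem plat_canonicalWord {n : ℕ} (D : {p : DyckWord // p.semilength = n}) :
    plat (canonicalWord D) = lowPeaks D.1 := by
  obtain ⟨D, rfl⟩ := D
  rw [lowPeaks, ← D.two_mul_semilength_eq_length, plat]
  refine card_filter_fin_eq_card_filter_range fun i => ⟨?_, fun h => ?_⟩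
  · rintro ⟨h, he⟩
    exact (D.letter_eq_succ_iff h).1 (congrArg Fin.val he)
  · have hi := D.add_one_lt_of_isPeakAt h.1
    exact ⟨hi, Fin.ext ((D.letter_eq_succ_iff hi).2 h)⟩

theorem fiberPoly_one (n : ℕ) : fiberPoly (1 : Equiv.Perm (Fin n)) = narayanaPoly n := by
  rw [fiberPoly, narayanaPoly]
  symm
  refine Finset.sum_nbij canonicalWord (fun D _ => ?_) (canonicalWord_injective n).injOn
    (fun c hc => ?_) fun D _ => ?_
  · obtain ⟨p, q, h, -⟩ := exists_isCanonicalWith_canonicalWord D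
    exact mem_canonicalWords.2 ⟨p, q, h⟩
  · obtain ⟨D, h⟩ := exists_canonicalWord_eq (Finset.mem_coe.1 hc)
    exact ⟨D, by simp, h⟩
  · have h1 : ⇑(1 : Equiv.Perm (Fin n)) ∘ canonicalWord D = canonicalWord D := rfl
    rw [h1, des_canonicalWord, plat_canonicalWord]

theorem theorem1 (n : ℕ) (hn : 1 ≤ n) :
    nonnestingPoly n =
      Polynomial.aeval (MvPolynomial.X 0 : MvPolynomial (Fin 2) ℤ) (eulerianPoly n) *
        narayanaPoly n := by
  obtain ⟨m, rfl⟩ := Nat.exists_eq_add_of_le' hn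
  rw [nonnestingPoly_eq_sum_fiberPoly, ← fiberPoly_one, eulerianPoly, map_sum, Finset.sum_mul]
  refine Finset.sum_congr rfl fun σ _ => ?_
  rw [fiberPoly_eq, map_pow, Polynomial.aeval_X]
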